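/- For $z=(x,\omega)\in\mathbb{R}^{2d}$ let $\pi(z)f(t)=e^{2\pi i\,\omega\cdot t}f(t-x)$ be the time-frequency shift on $L^2(\mathbb{R}^d)$, let $Pf(t)=f(-t)$, and for a bounded operator $T$ on $L^2(\mathbb{R}^d)$ put $\alpha_z(T)=\pi(z)T\pi(z)^*$ and $\check T=PTP$. For $f\in L^1(\mathbb{R}^{2d})$ and trace class operators $S,T$ put $f\star S=\int_{\mathbb{R}^{2d}}f(z)\,\alpha_z(S)\,dz$ and $S\star T(z)=\mathrm{tr}\big(S\,\alpha_z(\check T)\big)$, and let $\tilde S=S\star\check S$ be the total correlation function of $S$. **Theorem.** Let $\Omega\subset\mathbb{R}^{2d}$ be compact with Lebesgue measure $|\Omega|>0$, and let $S$ be a positive trace class operator on $L^2(\mathbb{R}^d)$ with $\mathrm{tr}(S)=1$. Then $$\log|\Omega|+\mathrm{ALC}(\tilde S,\Omega)\;\le\; H_{vN}\Big(\frac{\chi_\Omega}{|\Omega|}\star S\Big)\;\le\; H\Big(\frac{\chi_\Omega}{|\Omega|}*\tilde S\Big),$$ where $*$ is the usual convolution of functions on $\mathbb{R}^{2d}$,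 $$\mathrm{ALC}(\tilde S,\Omega)=\frac1{|\Omega|}\int_\Omega\Big(1-\int_{\Omega-z}\tilde S(z')\,dz'\Big)dz,$$ $H_{vN}(T)=-\mathrm{tr}(T\log T)$ is the von Neumann entropy of a density operator $T$ (a positive trace class operator of trace $1$), and $H(f)=-\int_{\mathbb{R}^{2d}}f(z)\log f(z)\,dz$ is the differential entropy of a probability density $f$. Both entropies are understood as elements of $[-\infty,\infty]$; the value $+\infty$ is allowed. -/

import Mathlib

open MeasureTheory
open scoped ENNReal InnerProductSpace

noncomputable section

namespace QHA

/-! ### Traces of operators on a Hilbert space -/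

section Trace

variable (H : Type*) [NormedAddCommGroup H] [InnerProductSpace ℂ H] [CompleteSpace H]

/-- The index set of a fixed orthonormal (Hilbert) basis of `H`. -/
def basisIndex : Set H := (exists_hilbertBasis ℂ H).choose

/-- A fixed orthonormal (Hilbert) basis of `H`, used to compute traces. The traces below do not
depend on this choice. -/
def onb : HilbertBasis (basisIndex H) ℂ H := (exists_hilbertBasis ℂ H).choose_spec.choose

variable {H}

/-- The trace `∑ᵢ ⟨T eᵢ, eᵢ⟩ ∈ [0, ∞]` of a positive bounded operator `T`. -/
def posTrace (T : H →L[ℂ] H) : ℝ≥0∞ :=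
  ∑' i, ENNReal.ofReal (⟪onb H i, T (onb H i)⟫_ℂ).re

/-- `T` is trace class: `tr |T| < ∞`, where `|T| = (T* T)^{1/2}`. -/
def IsTraceClass (T : H →L[ℂ] H) : Prop :=
  posTrace (CFC.abs T) < ∞

/-- The trace `tr T = ∑ᵢ ⟨T eᵢ, eᵢ⟩` of a trace class operator `T`. -/
def opTrace (T : H →L[ℂ] H) : ℂ :=
  ∑' i, ⟪onb H i, T (onb H i)⟫_ℂ

/-- The trace, as an extended real number, of a bounded self-adjoint operator `A`:
`tr A = tr A⁺ - tr A⁻`. It is meaningful if at most one of the two terms is infinite, in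
particular if `A` is positive, where it is the (possibly infinite) trace of `A`. -/
def extTrace (A : H →L[ℂ] H) : EReal :=
  (posTrace (A⁺) : EReal) - (posTrace (A⁻) : EReal)

/-- The von Neumann entropy `-tr (T log T)` of a density operator `T`, an extended real number:
the trace of `Φ(T)`, where `Φ(x) = -x log x` is applied through the continuous functional
calculus. -/
def vonNeumannEntropy (T : H →L[ℂ] H) : EReal :=
  extTrace (cfc Real.negMulLog T)

end Trace

/-! ### Time-frequency shifts -/

/-- The Hilbert space `L²(ℝᵈ)`. -/
abbrev L2 (d : ℕ) : Type := Lp ℂ 2 (volume : Measure (EuclideanSpace ℝ (Fin d)))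

/-- The phase space `ℝ²ᵈ = ℝᵈ × ℝᵈ`, with points `z = (x, ω)`. -/
abbrev Phase (d : ℕ) : Type := EuclideanSpace ℝ (Fin d) × EuclideanSpace ℝ (Fin d)

variable {d : ℕ}

/-- The function `t ↦ e^{2π i ω · t} f (t - x)`, for `z = (x, ω)`. -/
def shiftFun (z : Phase d) (f : EuclideanSpace ℝ (Fin d) → ℂ) (t : EuclideanSpace ℝ (Fin d)) : ℂ :=
  Complex.exp (2 * Real.pi * Complex.I * (⟪z.2, t⟫_ℝ : ℝ)) * f (t - z.1)

lemma norm_shiftFun (z : Phase d) (f : EuclideanSpace ℝ (Fin d) → ℂ)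
    (t : EuclideanSpace ℝ (Fin d)) : ‖shiftFun z f t‖ = ‖f (t - z.1)‖ := by
  have h : (2 * Real.pi * Complex.I * (⟪z.2, t⟫_ℝ : ℝ) : ℂ)
      = ((2 * Real.pi * ⟪z.2, t⟫_ℝ : ℝ) : ℂ) * Complex.I := by
    push_cast; ring
  rw [shiftFun, norm_mul, h, Complex.norm_exp_ofReal_mul_I, one_mul]

lemma memLp_shiftFun (z : Phase d) (f : L2 d) :
    MemLp (shiftFun z f) 2 (volume : Measure (EuclideanSpace ℝ (Fin d))) := by
  have h : MemLp (fun t => f (t - z.1)) 2 (volume : Measure (EuclideanSpace ℝ (Fin d))) :=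
    (Lp.memLp f).comp_measurePreserving (measurePreserving_sub_right volume z.1)
  refine h.of_le ?_ (Filter.Eventually.of_forall fun t => (norm_shiftFun z f t).le)
  refine AEStronglyMeasurable.mul (Continuous.aestronglyMeasurable ?_) h.1
  fun_prop

/-- The time-frequency shift `π(z)`, `π(z) f (t) = e^{2π i ω · t} f (t - x)` for `z = (x, ω)`, as a
linear isometry of `L²(ℝᵈ)`. -/
def tfShift (z : Phase d) : L2 d →ₗᵢ[ℂ] L2 d where
  toFun f := (memLp_shiftFun z f).toLp
  map_add' f g := by
    rw [← MemLp.toLp_add]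
    refine MemLp.toLp_congr _ _ ?_
    have h := (measurePreserving_sub_right volume z.1).quasiMeasurePreserving.ae
      (Lp.coeFn_add f g)
    filter_upwards [h] with t ht
    simp only [shiftFun, Pi.add_apply] at ht ⊢
    rw [ht, mul_add]
  map_smul' c f := by
    rw [RingHom.id_apply, ← MemLp.toLp_const_smul]
    refine MemLp.toLp_congr _ _ ?_
    have h := (measurePreserving_sub_right volume z.1).quasiMeasurePreserving.ae
      (Lp.coeFn_smul c f)
    filter_upwards [h] with t ht
    simp only [shiftFun, Pi.smul_apply, smul_eq_mul] at ht ⊢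
    rw [ht, mul_left_comm]
  norm_map' f := by
    change ‖(memLp_shiftFun z f).toLp‖ = ‖f‖
    rw [Lp.norm_toLp, Lp.norm_def]
    congr 1
    rw [← eLpNorm_comp_measurePreserving (Lp.aestronglyMeasurable f)
      (measurePreserving_sub_right volume z.1)]
    exact eLpNorm_congr_norm_ae (Filter.Eventually.of_forall (norm_shiftFun z f))

/-- The parity operator `P f (t) = f (-t)` on `L²(ℝᵈ)`. -/
def parity : L2 d →ₗᵢ[ℂ] L2 d :=
  Lp.compMeasurePreservingₗᵢ ℂ (fun t : EuclideanSpace ℝ (Fin d) => -t)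
    (Measure.measurePreserving_neg volume)

/-- The translation `α_z(S) = π(z) S π(z)*` of an operator `S`. -/
def opShift (z : Phase d) (S : L2 d →L[ℂ] L2 d) : L2 d →L[ℂ] L2 d :=
  (tfShift z).toContinuousLinearMap ∘L S ∘L
    ContinuousLinearMap.adjoint (tfShift z).toContinuousLinearMap

/-- `Š = P S P`, with `P` the parity operator. -/
def opCheck (S : L2 d →L[ℂ] L2 d) : L2 d →L[ℂ] L2 d :=
  parity.toContinuousLinearMap ∘L S ∘L parity.toContinuousLinearMap

/-! ### Convolutions -/

/-- The convolution `f ⋆ S = ∫ f(z) α_z(S) dz` of a function and an operator, a Bochner integral of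
operators. -/
def funOpConv (f : Phase d → ℂ) (S : L2 d →L[ℂ] L2 d) : L2 d →L[ℂ] L2 d :=
  ∫ z, f z • opShift z S

/-- The convolution `S ⋆ T (z) = tr (S α_z(Ť))` of two trace class operators. -/
def opConv (S T : L2 d →L[ℂ] L2 d) (z : Phase d) : ℂ :=
  opTrace (S ∘L opShift z (opCheck T))

/-- The total correlation function `S̃ = S ⋆ Š` of a positive trace class operator `S`; its values
are real. -/
def totalCorrelation (S : L2 d →L[ℂ] L2 d) (z : Phase d) : ℝ :=
  (opConv S (opCheck S) z).re

/-- The normalised indicator function `χ_Ω / |Ω|`. -/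
def normIndicator (Ω : Set (Phase d)) (z : Phase d) : ℝ :=
  Ω.indicator (fun _ => 1) z / volume.real Ω

/-- The convolution `f ∗ g (z) = ∫ f(z') g(z - z') dz'` of two functions on phase space. -/
def funConv (f g : Phase d → ℝ) : Phase d → ℝ :=
  convolution f g (ContinuousLinearMap.mul ℝ ℝ) volume

/-! ### Differential entropy and average lack of concentration -/

/-- The differential entropy `H(f) = -∫ f(z) log f(z) dz` of a probability density `f`, an extended
real number: the integral of the positive part of `-f log f` minus that of its negative part. -/
def diffEntropy (f : Phase d → ℝ) : EReal :=
  ((∫⁻ z, ENNReal.ofReal (Real.negMulLog (f z)) : ℝ≥0∞) : EReal) -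
    ((∫⁻ z, ENNReal.ofReal (-Real.negMulLog (f z)) : ℝ≥0∞) : EReal)

/-- The average lack of concentration
`ALC(g, Ω) = |Ω|⁻¹ ∫_Ω (1 - ∫_{Ω - z} g(z') dz') dz`. -/
def ALC (g : Phase d → ℝ) (Ω : Set (Phase d)) : ℝ :=
  1 / volume.real Ω * ∫ z in Ω, (1 - ∫ z' in (fun w => w - z) '' Ω, g z')

end QHA

end

/-!
The theorem rests on the functions `z ↦ tr (B α_z(S))`, `B ≥ 0`, and needs no diagonalisation of the
operators involved. Write `Φ(x) = -x log x`, `T = χ_Ω / |Ω| ⋆ S` (`QHA.mixedState`) and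
`p(z) = tr (T α_z(S))`. With `vᵢ = S ^ (1/2) eᵢ` one has `α_z(S) = ∑ᵢ π(z) vᵢ ⊗ π(z) vᵢ`, so that
`tr (B α_z(S)) = ∑ᵢ ⟨π(z) vᵢ, B π(z) vᵢ⟩` is a sum in `[0, ∞]` (`QHA.shiftTrace`), where sums and
integrals may be freely interchanged. In these terms `S̃(z) = tr (S α_z(S))`, `0 ≤ T ≤ 1`,
`tr T = 1` and `χ_Ω / |Ω| ∗ S̃ = p`.

*Upper bound.* As `∑ᵢ ‖π(z) vᵢ‖² = tr S = 1`, the operator inequality `Φ(T) ≤ a - (log a + 1) T`,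
given by the tangent line of the concave function `Φ` at `a = p(z)`, yields the Jensen inequality
`tr (Φ(T) α_z(S)) ≤ Φ(p(z))` (`QHA.tsum_quadForm_cfc_negMulLog_le`). Moyal's identity
(`QHA.lintegral_enorm_sq_inner_tfShift`), which comes from Plancherel's theorem, gives
`∫ tr (B α_z(S)) dz = tr B · tr S` (`QHA.lintegral_shiftTrace`). Integrating the inequality over
phase space gives `tr Φ(T) ≤ ∫ Φ(p(z)) dz`.

*Lower bound.* From `log y ≤ y - 1` at `y = |Ω| x` one gets the operator inequality
`Φ(T) ≥ (log |Ω| + 1) T - |Ω| T²`, hence `tr Φ(T) ≥ log |Ω| + 1 - |Ω| tr T²`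
(`QHA.le_vonNeumannEntropy`), while `tr T² = |Ω|⁻¹ ∫_Ω p` shows that `1 - |Ω| tr T²` is the average
lack of concentration of `S̃` on `Ω` (`QHA.ALC_totalCorrelation`).
-/

noncomputable section

/-! ### Plancherel's theorem -/

/-- The `L²` norm as a Lebesgue integral. -/
lemma enorm_sq_eq_lintegral {α : Type*} [MeasurableSpace α] {μ : Measure α} (f : Lp ℂ 2 μ) :
    ‖f‖ₑ ^ 2 = ∫⁻ t, ‖f t‖ₑ ^ 2 ∂μ := by
  rw [Lp.enorm_def, eLpNorm_eq_lintegral_rpow_enorm_toReal (by norm_num) (by norm_num)]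
  simp only [ENNReal.toReal_ofNat, one_div]
  rw [← ENNReal.rpow_natCast, ← ENNReal.rpow_mul]
  norm_num

open FourierTransform in
/-- The `L²` Fourier transform agrees with the Fourier integral on integrable functions: both have
the same pairing with every test function. -/
theorem fourier_ae_eq_Lp_fourier {V : Type*} [NormedAddCommGroup V] [InnerProductSpace ℝ V]
    [FiniteDimensional ℝ V] [MeasurableSpace V] [BorelSpace V] {g : V → ℂ}
    (h1 : Integrable g) (h2 : MemLp g 2) :
    (𝓕 (h2.toLp g) : Lp ℂ 2 (volume : Measure V)) =ᵐ[volume] 𝓕 g := by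
  have hcont : Continuous (𝓕 g) :=
    VectorFourier.fourierIntegral_continuous Real.continuous_fourierChar
      (by exact continuous_inner) h1
  refine ae_eq_of_integral_contDiff_smul_eq ((Lp.memLp _).locallyIntegrable (by norm_num))
    hcont.locallyIntegrable fun φ hφ hφc => ?_
  have hc : HasCompactSupport (Complex.ofRealCLM ∘ φ) := hφc.comp_left rfl
  have hs : ContDiff ℝ (⊤ : ℕ∞) (Complex.ofRealCLM ∘ φ) := by fun_prop
  set ψ : SchwartzMap V ℂ := hc.toSchwartzMap hs with hψ
  have hψφ : ∀ x, ψ x = (φ x : ℂ) := fun x => rfl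
  have key := congrArg (fun T => T ψ) (Lp.fourier_toTemperedDistribution_eq (h2.toLp g))
  simp only [TemperedDistribution.fourier_apply, Lp.toTemperedDistribution_apply] at key
  have e1 : ∫ x, (𝓕 ψ) x • (h2.toLp g) x = ∫ x, (𝓕 ψ) x • g x := by
    refine integral_congr_ae ?_
    filter_upwards [h2.coeFn_toLp] with x hx
    rw [hx]
  have e2 : ∫ ξ, (𝓕 ψ) ξ • g ξ = ∫ x, ψ x • (𝓕 g) x := by
    have := VectorFourier.integral_fourierIntegral_smul_eq_flip (μ := (volume : Measure V))
      (ν := (volume : Measure V)) (L := innerₗ V) (f := ψ) (g := g)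
      Real.continuous_fourierChar continuous_inner ψ.integrable h1
    rw [flip_innerₗ] at this
    rw [SchwartzMap.fourier_coe]
    exact this
  rw [e1, e2] at key
  simp only [hψφ] at key
  simpa using key.symm

open FourierTransform in
/-- Plancherel's theorem for integrable and square integrable functions. -/
theorem lintegral_enorm_sq_fourier {V : Type*} [NormedAddCommGroup V] [InnerProductSpace ℝ V]
    [FiniteDimensional ℝ V] [MeasurableSpace V] [BorelSpace V] {g : V → ℂ}
    (h1 : Integrable g) (h2 : MemLp g 2) :
    ∫⁻ ω, ‖𝓕 g ω‖ₑ ^ 2 = ∫⁻ t, ‖g t‖ₑ ^ 2 := by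
  calc ∫⁻ ω, ‖𝓕 g ω‖ₑ ^ 2
      = ∫⁻ ω, ‖(𝓕 (h2.toLp g) : Lp ℂ 2 (volume : Measure V)) ω‖ₑ ^ 2 := by
        refine lintegral_congr_ae ?_
        filter_upwards [fourier_ae_eq_Lp_fourier h1 h2] with ω h
        rw [h]
    _ = ‖h2.toLp g‖ₑ ^ 2 := by
        rw [← enorm_sq_eq_lintegral, ← ofReal_norm, Lp.norm_fourier_eq, ofReal_norm]
    _ = ∫⁻ t, ‖g t‖ₑ ^ 2 := by
        rw [enorm_sq_eq_lintegral]
        refine lintegral_congr_ae ?_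
        filter_upwards [h2.coeFn_toLp] with ω h
        rw [h]

namespace QHA

/-! ### Time-frequency shifts and Moyal's identity -/

section TimeFrequency

variable {d : ℕ}

instance : (volume : Measure (Phase d)).IsAddHaarMeasure :=
  inferInstanceAs ((volume : Measure (EuclideanSpace ℝ (Fin d))).prod volume).IsAddHaarMeasure

instance : SecondCountableTopology (L2 d) :=
  have : Fact ((2 : ℝ≥0∞) ≠ ∞) := ⟨by norm_num⟩
  Lp.SecondCountableTopology

lemma coeFn_tfShift (z : Phase d) (f : L2 d) : tfShift z f =ᵐ[volume] shiftFun z f :=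
  (memLp_shiftFun z f).coeFn_toLp

/-- Time-frequency shifts compose up to a phase: they form a projective representation. -/
lemma tfShift_tfShift (a b : Phase d) (f : L2 d) :
    tfShift a (tfShift b f) =
      Complex.exp ((-(2 * Real.pi * ⟪b.2, a.1⟫_ℝ) : ℝ) * Complex.I) • tfShift (a + b) f := by
  refine Lp.ext ?_
  have h := (measurePreserving_sub_right volume a.1).quasiMeasurePreserving.ae (coeFn_tfShift b f)
  filter_upwards [coeFn_tfShift a (tfShift b f), coeFn_tfShift (a + b) f, h,
    Lp.coeFn_smul (Complex.exp ((-(2 * Real.pi * ⟪b.2, a.1⟫_ℝ) : ℝ) * Complex.I))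
      (tfShift (a + b) f)] with t h1 h2 h3 h4
  rw [h1, h4, Pi.smul_apply, h2, smul_eq_mul, shiftFun, h3, shiftFun, shiftFun, ← mul_assoc,
    ← mul_assoc, ← Complex.exp_add, ← Complex.exp_add]
  congr 2
  · rw [inner_sub_right, Prod.snd_add, inner_add_left]
    push_cast
    ring
  · rw [sub_sub, Prod.fst_add]

lemma norm_inner_tfShift_sub (z t : Phase d) (u v : L2 d) :
    ‖⟪v, tfShift (z - t) u⟫_ℂ‖ = ‖⟪tfShift t v, tfShift z u⟫_ℂ‖ := by
  have h := tfShift_tfShift t (z - t) u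
  rw [add_sub_cancel] at h
  rw [← (tfShift t).inner_map_map, h, inner_smul_right, norm_mul, Complex.norm_exp_ofReal_mul_I,
    one_mul]

/-- The orbit maps of the time-frequency shifts are norm continuous. -/
lemma continuous_tfShift (f : L2 d) : Continuous fun z : Phase d => tfShift z f := by
  have : Fact ((2 : ℝ≥0∞) ≠ ∞) := ⟨by norm_num⟩
  -- Translations act continuously on `Lᵖ` for `p < ∞`; modulations by dominated convergence.
  have htrans : Continuous fun x : EuclideanSpace ℝ (Fin d) => tfShift (x, 0) f := by
    have h0 : Continuous fun x : EuclideanSpace ℝ (Fin d) => DomAddAct.mk (-x) +ᵥ f :=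
      (DomAddAct.continuous_mk.comp continuous_neg).vadd continuous_const
    refine h0.congr fun x => Lp.ext ?_
    filter_upwards [coeFn_tfShift (x, 0) f, DomAddAct.vadd_Lp_ae_eq (DomAddAct.mk (-x)) f]
      with t h1 h2
    rw [h1, h2]
    simp [shiftFun, sub_eq_neg_add]
  have hmod : ∀ g : L2 d, Continuous fun ω : EuclideanSpace ℝ (Fin d) => tfShift (0, ω) g := by
    intro g
    refine continuous_iff_continuousAt.2 fun ω₀ => ?_
    rw [ContinuousAt, tendsto_iff_edist_tendsto_0]
    have hsq : Filter.Tendsto (fun ω => edist (tfShift (0, ω) g) (tfShift (0, ω₀) g) ^ 2)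
        (nhds ω₀) (nhds 0) := by
      have heq : ∀ ω, edist (tfShift (0, ω) g) (tfShift (0, ω₀) g) ^ 2 =
          ∫⁻ t, ‖shiftFun (0, ω) g t - shiftFun (0, ω₀) g t‖ₑ ^ 2 := by
        intro ω
        rw [edist_eq_enorm_sub, enorm_sq_eq_lintegral]
        refine lintegral_congr_ae ?_
        filter_upwards [Lp.coeFn_sub (tfShift (0, ω) g) (tfShift (0, ω₀) g),
          coeFn_tfShift (0, ω) g, coeFn_tfShift (0, ω₀) g] with t h1 h2 h3
        rw [h1, Pi.sub_apply, h2, h3]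
      simp only [heq]
      have hfin : ∫⁻ t, (2 * ‖g t‖ₑ) ^ 2 ≠ ∞ := by
        simp only [mul_pow]
        rw [lintegral_const_mul' _ _ (by norm_num), ← enorm_sq_eq_lintegral]
        exact ENNReal.mul_ne_top (by norm_num) (by simp)
      have := tendsto_lintegral_filter_of_dominated_convergence (μ := volume) (l := nhds ω₀)
        (F := fun ω t => ‖shiftFun (0, ω) g t - shiftFun (0, ω₀) g t‖ₑ ^ 2) (f := fun _ => 0)
        (fun t => (2 * ‖g t‖ₑ) ^ 2) ?_ ?_ hfin ?_
      · simpa using this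
      · refine Filter.Eventually.of_forall fun ω => ?_
        have hg : Measurable (g : EuclideanSpace ℝ (Fin d) → ℂ) :=
          (Lp.stronglyMeasurable g).measurable
        have hm : ∀ ω : EuclideanSpace ℝ (Fin d), Measurable (shiftFun (0, ω) g) := by
          intro ω
          refine Measurable.mul (Continuous.measurable (by fun_prop)) (hg.comp (by fun_prop))
        exact ((hm ω).sub (hm ω₀)).enorm.pow_const 2
      · refine Filter.Eventually.of_forall fun ω => Filter.Eventually.of_forall fun t => ?_
        gcongr
        refine enorm_sub_le.trans (le_of_eq ?_)
        have h : ∀ ω : EuclideanSpace ℝ (Fin d), ‖shiftFun (0, ω) g t‖ₑ = ‖g t‖ₑ := by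
          intro ω
          rw [← ofReal_norm, norm_shiftFun, ofReal_norm]
          simp
        rw [h, h, two_mul]
      · refine Filter.Eventually.of_forall fun t => ?_
        have hc : Continuous fun ω : EuclideanSpace ℝ (Fin d) =>
            ‖shiftFun (0, ω) g t - shiftFun (0, ω₀) g t‖ₑ ^ 2 := by
          refine (ENNReal.continuous_pow 2).comp (Continuous.enorm ?_)
          simp only [shiftFun]
          fun_prop
        simpa using hc.tendsto ω₀
    have := ((ENNReal.continuous_rpow_const (y := 1 / 2)).tendsto 0).comp hsq
    rw [ENNReal.zero_rpow_of_pos (by norm_num)] at this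
    refine this.congr fun ω => ?_
    simp only [Function.comp_apply]
    rw [← ENNReal.rpow_natCast, ← ENNReal.rpow_mul]
    norm_num
  have hdec : ∀ z : Phase d, tfShift z f = tfShift (0, z.2) (tfShift (z.1, 0) f) := by
    intro z
    rw [tfShift_tfShift]
    simp
  refine continuous_iff_continuousAt.2 fun z₀ => ?_
  rw [ContinuousAt, tendsto_iff_dist_tendsto_zero]
  have h1 : Filter.Tendsto (fun z : Phase d => dist (tfShift (z.1, 0) f) (tfShift (z₀.1, 0) f) +
      dist (tfShift (0, z.2) (tfShift (z₀.1, 0) f)) (tfShift (0, z₀.2) (tfShift (z₀.1, 0) f)))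
      (nhds z₀) (nhds 0) := by
    have hc : Continuous fun z : Phase d => dist (tfShift (z.1, 0) f) (tfShift (z₀.1, 0) f) +
      dist (tfShift (0, z.2) (tfShift (z₀.1, 0) f)) (tfShift (0, z₀.2) (tfShift (z₀.1, 0) f)) :=
      ((htrans.comp continuous_fst).dist continuous_const).add
        (((hmod _).comp continuous_snd).dist continuous_const)
    simpa using hc.tendsto z₀
  refine squeeze_zero (fun _ => dist_nonneg) (fun z => ?_) h1
  rw [hdec z, hdec z₀]
  refine (dist_triangle _ (tfShift (0, z.2) (tfShift (z₀.1, 0) f)) _).trans ?_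
  rw [(tfShift (0, z.2)).dist_map]

lemma inner_tfShift_eq_fourier (x ω : EuclideanSpace ℝ (Fin d)) (u v : L2 d) :
    ⟪tfShift (x, ω) u, v⟫_ℂ =
      FourierTransform.fourier (fun t => starRingEnd ℂ (u (t - x)) * v t) ω := by
  rw [L2.inner_def, Real.fourier_eq]
  refine integral_congr_ae ?_
  filter_upwards [coeFn_tfShift (x, ω) u] with t h
  rw [h, RCLike.inner_apply, shiftFun, map_mul, Circle.smul_def, Real.fourierChar_apply,
    ← Complex.exp_conj, smul_eq_mul]
  have : starRingEnd ℂ (2 * Real.pi * Complex.I * (⟪ω, t⟫_ℝ : ℝ)) =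
      ((2 * Real.pi * -⟪t, ω⟫_ℝ : ℝ) : ℂ) * Complex.I := by
    rw [real_inner_comm]
    simp only [map_mul, map_ofNat, Complex.conj_ofReal, Complex.conj_I]
    push_cast
    ring
  simp only [this]
  ring

/-- Moyal's identity: the orthogonality relation of the time-frequency shifts. -/
theorem lintegral_enorm_sq_inner_tfShift (u v : L2 d) :
    ∫⁻ z : Phase d, ‖⟪tfShift z u, v⟫_ℂ‖ₑ ^ 2 = ‖u‖ₑ ^ 2 * ‖v‖ₑ ^ 2 := by
  have hu : Measurable (u : EuclideanSpace ℝ (Fin d) → ℂ) := (Lp.stronglyMeasurable u).measurable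
  have hv : Measurable (v : EuclideanSpace ℝ (Fin d) → ℂ) := (Lp.stronglyMeasurable v).measurable
  have hm : Measurable fun z : Phase d => ‖⟪tfShift z u, v⟫_ℂ‖ₑ ^ 2 :=
    (((continuous_tfShift u).inner continuous_const).enorm.measurable).pow_const 2
  have hjoint : Measurable (Function.uncurry fun x t : EuclideanSpace ℝ (Fin d) =>
      ‖u (t - x)‖ₑ ^ 2 * ‖v t‖ₑ ^ 2) :=
    ((hu.comp (measurable_snd.sub measurable_fst)).enorm.pow_const 2).mul
      ((hv.comp measurable_snd).enorm.pow_const 2)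
  have htot : ∫⁻ x : EuclideanSpace ℝ (Fin d), ∫⁻ t, ‖u (t - x)‖ₑ ^ 2 * ‖v t‖ₑ ^ 2 =
      ‖u‖ₑ ^ 2 * ‖v‖ₑ ^ 2 := by
    rw [lintegral_lintegral_swap hjoint.aemeasurable]
    have : ∀ t : EuclideanSpace ℝ (Fin d), ∫⁻ x, ‖u (t - x)‖ₑ ^ 2 * ‖v t‖ₑ ^ 2 =
        ‖u‖ₑ ^ 2 * ‖v t‖ₑ ^ 2 := by
      intro t
      rw [lintegral_mul_const' _ _ (by simp),
        lintegral_sub_left_eq_self (fun x => ‖u x‖ₑ ^ 2), enorm_sq_eq_lintegral u]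
    simp only [this]
    rw [lintegral_const_mul' _ _ (by simp), enorm_sq_eq_lintegral v]
  -- For almost every translate the product is square integrable, so Plancherel applies to it.
  have hae : ∀ᵐ x : EuclideanSpace ℝ (Fin d), ∫⁻ t, ‖u (t - x)‖ₑ ^ 2 * ‖v t‖ₑ ^ 2 < ∞ := by
    refine ae_lt_top hjoint.lintegral_prod_right' ?_
    rw [htot]
    exact ENNReal.mul_ne_top (by simp) (by simp)
  rw [← htot, Measure.volume_eq_prod, lintegral_prod _ hm.aemeasurable]
  refine lintegral_congr_ae ?_
  filter_upwards [hae] with x hx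
  simp only [inner_tfShift_eq_fourier]
  have hprod : Measurable fun t => starRingEnd ℂ (u (t - x)) * v t :=
    ((RCLike.continuous_conj.measurable).comp (hu.comp (measurable_id.sub_const x))).mul hv
  have hen : ∀ t, ‖starRingEnd ℂ (u (t - x)) * v t‖ₑ ^ 2 = ‖u (t - x)‖ₑ ^ 2 * ‖v t‖ₑ ^ 2 := by
    intro t
    rw [enorm_mul, mul_pow, RCLike.enorm_conj]
  have h1 : Integrable fun t => starRingEnd ℂ (u (t - x)) * v t := by
    have hux : MemLp (fun t => starRingEnd ℂ (u (t - x))) 2 volume :=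
      ((Lp.memLp u).comp_measurePreserving (measurePreserving_sub_right volume x)).star
    exact hux.integrable_mul (Lp.memLp v)
  have h2 : MemLp (fun t => starRingEnd ℂ (u (t - x)) * v t) 2 := by
    refine ⟨hprod.aestronglyMeasurable, ?_⟩
    rw [eLpNorm_lt_top_iff_lintegral_rpow_enorm_lt_top (by norm_num) (by norm_num)]
    simp only [ENNReal.toReal_ofNat]
    have : ∀ t, ‖starRingEnd ℂ (u (t - x)) * v t‖ₑ ^ (2 : ℝ) = ‖u (t - x)‖ₑ ^ 2 * ‖v t‖ₑ ^ 2 := by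
      intro t
      rw [← hen, ← ENNReal.rpow_natCast]
      norm_num
    simpa only [this] using hx
  rw [lintegral_enorm_sq_fourier h1 h2]
  simp only [hen]

end TimeFrequency

/-! ### Positive trace class operators -/

lemma summable_norm_sq_of_tsum_ne_top {ι E : Type*} [NormedAddCommGroup E] {f : ι → E}
    (h : ∑' i, ‖f i‖ₑ ^ 2 ≠ ∞) :
    Summable fun i => ‖f i‖ ^ 2 := by
  have := ENNReal.summable_toReal h
  simpa using this

section InnerProduct

variable {H : Type*} [NormedAddCommGroup H] [InnerProductSpace ℂ H]

lemma enorm_inner_comm (x y : H) : ‖⟪x, y⟫_ℂ‖ₑ = ‖⟪y, x⟫_ℂ‖ₑ := by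
  rw [← ofReal_norm, norm_inner_symm, ofReal_norm]

/-- The quadratic form `u ↦ ⟨u, B u⟩` of an operator `B`, truncated to `[0, ∞]`. -/
def quadForm (B : H →L[ℂ] H) (u : H) : ℝ≥0∞ := ENNReal.ofReal (⟪u, B u⟫_ℂ).re

lemma quadForm_ne_top (B : H →L[ℂ] H) (u : H) : quadForm B u ≠ ∞ := ENNReal.ofReal_ne_top

lemma re_inner_nonneg {B : H →L[ℂ] H} (hB : 0 ≤ B) (u : H) : 0 ≤ (⟪u, B u⟫_ℂ).re :=
  ((ContinuousLinearMap.nonneg_iff_isPositive B).1 hB).re_inner_nonneg_right u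

lemma toReal_quadForm {B : H →L[ℂ] H} (hB : 0 ≤ B) (u : H) :
    (quadForm B u).toReal = (⟪u, B u⟫_ℂ).re :=
  ENNReal.toReal_ofReal (re_inner_nonneg hB u)

lemma ofReal_re_inner {B : H →L[ℂ] H} (hB : 0 ≤ B) (u : H) :
    (((⟪u, B u⟫_ℂ).re : ℝ) : ℂ) = ⟪u, B u⟫_ℂ := by
  have h := ((ContinuousLinearMap.nonneg_iff_isPositive B).1 hB).inner_nonneg_right u
  rw [Complex.le_def] at h
  exact Complex.ext (by simp) (by simpa using h.2)

lemma continuous_rankOne_self :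
    Continuous fun x : H => InnerProductSpace.rankOne ℂ x x := by
  -- `Continuous.clm_apply` needs a linear map, so the conjugate linear variable is applied first.
  have h : Continuous fun p : H × H =>
      (InnerProductSpace.rankOne ℂ (E := H) (F := H)).flip p.1 p.2 :=
    ((InnerProductSpace.rankOne ℂ (E := H) (F := H)).flip.continuous.comp continuous_fst).clm_apply
      continuous_snd
  exact h.comp (continuous_id.prodMk continuous_id)

end InnerProduct

section Hilbert

variable {H : Type*} [NormedAddCommGroup H] [InnerProductSpace ℂ H] [CompleteSpace H]

/-- The balls of radius `1 / 2` about the vectors of an orthonormal basis are disjoint. -/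
instance [TopologicalSpace.SeparableSpace H] : Countable (basisIndex H) := by
  have hdist : ∀ i j : basisIndex H, i ≠ j → 1 ≤ dist (onb H i) (onb H j) := by
    intro i j hij
    have h1 : ‖onb H i - onb H j‖ * ‖onb H i - onb H j‖ = 2 := by
      have h0 : ⟪onb H i, onb H j⟫_ℂ = 0 := (onb H).orthonormal.inner_eq_zero hij
      have := norm_sub_mul_self (𝕜 := ℂ) (onb H i) (onb H j)
      rw [h0, (onb H).orthonormal.norm_eq_one, (onb H).orthonormal.norm_eq_one] at this
      rw [this]
      norm_num
    rw [dist_eq_norm]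
    nlinarith [norm_nonneg (onb H i - onb H j)]
  refine Pairwise.countable_of_isOpen_disjoint (s := fun i => Metric.ball (onb H i) (1 / 2))
    (fun i j hij => ?_) (fun _ => Metric.isOpen_ball) (fun i => ⟨onb H i, by simp⟩)
  refine Metric.ball_disjoint_ball ?_
  norm_num
  exact hdist i j hij

/-- Parseval's identity in `[0, ∞]`. -/
lemma tsum_enorm_sq_inner_onb (x : H) : ∑' i, ‖⟪onb H i, x⟫_ℂ‖ₑ ^ 2 = ‖x‖ₑ ^ 2 := by
  have h := (onb H).hasSum_inner_mul_inner x x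
  have h' := Complex.hasSum_re h
  have hterm : ∀ i, (⟪x, onb H i⟫_ℂ * ⟪onb H i, x⟫_ℂ).re = ‖⟪onb H i, x⟫_ℂ‖ ^ 2 := by
    intro i
    rw [← inner_conj_symm x, Complex.conj_mul']
    norm_cast
  have hx : (⟪x, x⟫_ℂ).re = ‖x‖ ^ 2 := by
    rw [inner_self_eq_norm_sq_to_K]
    norm_cast
  simp only [hterm, hx] at h'
  have h2 := ENNReal.ofReal_tsum_of_nonneg (fun i => sq_nonneg ‖⟪onb H i, x⟫_ℂ‖) h'.summable
  rw [h'.tsum_eq] at h2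
  simp only [ENNReal.ofReal_pow (norm_nonneg _), ofReal_norm] at h2
  exact h2.symm

lemma posTrace_eq_tsum_quadForm (B : H →L[ℂ] H) : posTrace B = ∑' i, quadForm B (onb H i) := rfl

lemma inner_sqrt_left (B : H →L[ℂ] H) (x y : H) :
    ⟪CFC.sqrt B x, y⟫_ℂ = ⟪x, CFC.sqrt B y⟫_ℂ :=
  ((ContinuousLinearMap.nonneg_iff_isPositive _).1 (CFC.sqrt_nonneg B)).inner_left_eq_inner_right
    x y

lemma sqrt_sqrt_apply {B : H →L[ℂ] H} (hB : 0 ≤ B) (x : H) :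
    CFC.sqrt B (CFC.sqrt B x) = B x := by
  conv_rhs => rw [← CFC.sqrt_mul_sqrt_self B hB]
  rfl

lemma quadForm_eq_enorm_sqrt {B : H →L[ℂ] H} (hB : 0 ≤ B) (u : H) :
    quadForm B u = ‖CFC.sqrt B u‖ₑ ^ 2 := by
  rw [quadForm, ← sqrt_sqrt_apply hB, ← inner_sqrt_left, inner_self_eq_norm_sq_to_K,
    ← ofReal_norm, ← ENNReal.ofReal_pow (norm_nonneg _)]
  congr 1
  norm_cast

/-- The vectors `v i = B ^ (1/2) (e i)`; a positive operator `B` is the sum of the rank one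
operators `v i ⊗ v i`. -/
def sqrtVec (B : H →L[ℂ] H) (i : basisIndex H) : H := CFC.sqrt B (onb H i)

lemma quadForm_eq_tsum {B : H →L[ℂ] H} (hB : 0 ≤ B) (u : H) :
    quadForm B u = ∑' i, ‖⟪sqrtVec B i, u⟫_ℂ‖ₑ ^ 2 := by
  rw [quadForm_eq_enorm_sqrt hB, ← tsum_enorm_sq_inner_onb]
  simp only [sqrtVec, inner_sqrt_left]

lemma tsum_enorm_sq_sqrtVec {B : H →L[ℂ] H} (hB : 0 ≤ B) :
    ∑' i, ‖sqrtVec B i‖ₑ ^ 2 = posTrace B := by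
  simp only [posTrace_eq_tsum_quadForm, quadForm_eq_enorm_sqrt hB, sqrtVec]

lemma opTrace_eq_toReal_posTrace {S : H →L[ℂ] H} (hS : 0 ≤ S) :
    opTrace S = (((posTrace S).toReal : ℝ) : ℂ) := by
  rw [posTrace_eq_tsum_quadForm, ENNReal.tsum_toReal_eq (fun i => quadForm_ne_top _ _),
    Complex.ofReal_tsum]
  refine tsum_congr fun i => ?_
  rw [toReal_quadForm hS, ofReal_re_inner hS]

/-- The hypothesis `opTrace S = 1` already forces the trace to be finite, as `∞.toReal = 0`. -/
lemma posTrace_eq_one {S : H →L[ℂ] H} (hS : 0 ≤ S) (h : opTrace S = 1) : posTrace S = 1 := by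
  rw [opTrace_eq_toReal_posTrace hS] at h
  have h1 : (posTrace S).toReal = 1 := by exact_mod_cast h
  rwa [ENNReal.toReal_eq_one_iff] at h1

/-- The decomposition of a positive trace class operator into rank one operators converges in
operator norm. -/
lemma hasSum_rankOne_sqrtVec {S : H →L[ℂ] H} (hS : 0 ≤ S) (hfin : posTrace S ≠ ∞) :
    HasSum (fun i => InnerProductSpace.rankOne ℂ (sqrtVec S i) (sqrtVec S i)) S := by
  have hsum : Summable fun i => ‖sqrtVec S i‖ ^ 2 :=
    summable_norm_sq_of_tsum_ne_top (by rwa [tsum_enorm_sq_sqrtVec hS])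
  have hs : Summable fun i => InnerProductSpace.rankOne ℂ (sqrtVec S i) (sqrtVec S i) := by
    refine Summable.of_norm_bounded hsum fun i => ?_
    rw [InnerProductSpace.norm_rankOne, sq]
  convert hs.hasSum
  ext x
  have h1 : HasSum (fun i => InnerProductSpace.rankOne ℂ (sqrtVec S i) (sqrtVec S i) x)
      ((∑' i, InnerProductSpace.rankOne ℂ (sqrtVec S i) (sqrtVec S i)) x) :=
    hs.hasSum.mapL (ContinuousLinearMap.apply ℂ H x)
  have h2 : HasSum (fun i => InnerProductSpace.rankOne ℂ (sqrtVec S i) (sqrtVec S i) x) (S x) := by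
    have := ((onb H).hasSum_repr (CFC.sqrt S x)).mapL (CFC.sqrt S)
    rw [sqrt_sqrt_apply hS] at this
    refine this.congr_fun fun i => ?_
    simp [HilbertBasis.repr_apply_apply, sqrtVec, inner_sqrt_left]
  exact h2.unique h1

/-- The trace of a product `S X` of positive operators, `S` of trace class, is
`∑ₖ ⟨vₖ, X vₖ⟩` with `vₖ = S ^ (1/2) eₖ`. -/
lemma opTrace_comp {S X : H →L[ℂ] H} (hS : 0 ≤ S) (hfin : posTrace S ≠ ∞) (hX : 0 ≤ X) :
    opTrace (S ∘L X) = (((∑' k, quadForm X (sqrtVec S k)).toReal : ℝ) : ℂ) := by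
  set F : basisIndex H × basisIndex H → ℂ := fun p =>
    ⟪onb H p.1, sqrtVec S p.2⟫_ℂ * ⟪X (sqrtVec S p.2), onb H p.1⟫_ℂ with hF
  have hS1 := (ContinuousLinearMap.nonneg_iff_isPositive S).1 hS
  have hX1 := (ContinuousLinearMap.nonneg_iff_isPositive X).1 hX
  have hpair : ∀ w : basisIndex H → H, ∑' k, ‖w k‖ₑ ^ 2 ≠ ∞ →
      Summable fun p : basisIndex H × basisIndex H => ‖⟪onb H p.1, w p.2⟫_ℂ‖ ^ 2 := by
    intro w hw
    have h : ∑' p : basisIndex H × basisIndex H, ‖⟪onb H p.1, w p.2⟫_ℂ‖ₑ ^ 2 ≠ ∞ := by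
      rw [ENNReal.tsum_prod (f := fun i k => ‖⟪onb H i, w k⟫_ℂ‖ₑ ^ 2), ENNReal.tsum_comm]
      simpa only [tsum_enorm_sq_inner_onb] using hw
    exact summable_norm_sq_of_tsum_ne_top h
  have hv : ∑' k, ‖sqrtVec S k‖ₑ ^ 2 ≠ ∞ := by rwa [tsum_enorm_sq_sqrtVec hS]
  have hXv : ∑' k, ‖X (sqrtVec S k)‖ₑ ^ 2 ≠ ∞ := by
    have : ∑' k, ‖X (sqrtVec S k)‖ₑ ^ 2 ≤ ‖X‖ₑ ^ 2 * ∑' k, ‖sqrtVec S k‖ₑ ^ 2 := by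
      rw [← ENNReal.tsum_mul_left]
      refine ENNReal.tsum_le_tsum fun k => ?_
      rw [← mul_pow]
      gcongr
      exact X.le_opENorm _
    exact ne_top_of_le_ne_top (ENNReal.mul_ne_top (by simp) hv) this
  -- `2 |x y| ≤ |x|² + |y|²` bounds the double series by Hilbert-Schmidt norms.
  have hsum : Summable F := by
    refine Summable.of_norm_bounded ((hpair _ hv).add (hpair _ hXv)) fun p => ?_
    rw [hF, norm_mul, norm_inner_symm (X _)]
    nlinarith [sq_nonneg (‖⟪onb H p.1, sqrtVec S p.2⟫_ℂ‖ - ‖⟪onb H p.1, X (sqrtVec S p.2)⟫_ℂ‖),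
      sq_nonneg (‖⟪onb H p.1, sqrtVec S p.2⟫_ℂ‖ + ‖⟪onb H p.1, X (sqrtVec S p.2)⟫_ℂ‖)]
  have h1 : ∀ i, ⟪onb H i, (S ∘L X) (onb H i)⟫_ℂ = ∑' k, F (i, k) := by
    intro i
    rw [ContinuousLinearMap.comp_apply, ← hS1.inner_left_eq_inner_right, ← sqrt_sqrt_apply hS,
      inner_sqrt_left, ← (onb H).tsum_inner_mul_inner]
    refine tsum_congr fun k => ?_
    rw [hF, inner_sqrt_left, ← inner_sqrt_left _ (onb H k), ← hX1.inner_left_eq_inner_right]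
    rfl
  have h2 : ∀ k, ∑' i, F (i, k) = (((quadForm X (sqrtVec S k)).toReal : ℝ) : ℂ) := by
    intro k
    rw [toReal_quadForm hX, ofReal_re_inner hX, ← hX1.inner_left_eq_inner_right,
      ← (onb H).tsum_inner_mul_inner]
    exact tsum_congr fun i => mul_comm _ _
  rw [ENNReal.tsum_toReal_eq (fun i => quadForm_ne_top _ _), Complex.ofReal_tsum, opTrace]
  simp only [h1, ← h2]
  exact (Summable.tsum_comm (f := fun i k => F (i, k)) hsum).symm

end Hilbert

/-! ### Entropy inequalities for a density operator -/

/-- The graph of `-x log x` lies below its tangent line at `a`. -/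
lemma negMulLog_le_tangent {a x : ℝ} (ha : 0 < a) (hx : 0 ≤ x) :
    Real.negMulLog x ≤ a - (Real.log a + 1) * x := by
  rcases hx.eq_or_lt with rfl | hx
  · simpa using ha.le
  have h := Real.log_le_sub_one_of_pos (div_pos ha hx)
  rw [Real.log_div ha.ne' hx.ne'] at h
  have h2 := mul_le_mul_of_nonneg_left h hx.le
  have h3 : x * (a / x - 1) = a - x := by field_simp
  rw [h3] at h2
  rw [Real.negMulLog]
  linarith

/-- The inequality `log y ≤ y - 1` at `y = c x`. -/
lemma le_negMulLog {c x : ℝ} (hc : 0 < c) (hx : 0 ≤ x) :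
    (Real.log c + 1) * x - c * x ^ 2 ≤ Real.negMulLog x := by
  rcases hx.eq_or_lt with rfl | hx
  · simp
  have h := Real.log_le_sub_one_of_pos (mul_pos hc hx)
  rw [Real.log_mul hc.ne' hx.ne'] at h
  have h2 := mul_le_mul_of_nonneg_left h hx.le
  rw [Real.negMulLog]
  linarith

section Entropy

variable {H : Type*} [NormedAddCommGroup H] [InnerProductSpace ℂ H] [CompleteSpace H]

lemma re_inner_mono {A B : H →L[ℂ] H} (h : A ≤ B) (u : H) :
    (⟪u, A u⟫_ℂ).re ≤ (⟪u, B u⟫_ℂ).re := by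
  have := re_inner_nonneg (sub_nonneg.2 h) u
  rw [sub_apply, inner_sub_right, Complex.sub_re] at this
  linarith

lemma spectrum_mem_unitInterval {T : H →L[ℂ] H} (h0 : 0 ≤ T) (h1 : T ≤ 1) :
    ∀ x ∈ spectrum ℝ T, 0 ≤ x ∧ x ≤ 1 := by
  have hsa : IsSelfAdjoint T := IsSelfAdjoint.of_nonneg h0
  have h := (le_algebraMap_iff_spectrum_le (r := (1 : ℝ)) (a := T)).1 (by simpa using h1)
  exact fun x hx => ⟨spectrum_nonneg_of_nonneg h0 hx, h x hx⟩

lemma cfc_negMulLog_nonneg {T : H →L[ℂ] H} (h0 : 0 ≤ T) (h1 : T ≤ 1) :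
    0 ≤ cfc Real.negMulLog T :=
  cfc_nonneg fun x hx =>
    Real.negMulLog_nonneg (spectrum_mem_unitInterval h0 h1 x hx).1
      (spectrum_mem_unitInterval h0 h1 x hx).2

lemma vonNeumannEntropy_eq_posTrace {T : H →L[ℂ] H} (h0 : 0 ≤ T) (h1 : T ≤ 1) :
    vonNeumannEntropy T = (posTrace (cfc Real.negMulLog T) : EReal) := by
  have h := cfc_negMulLog_nonneg h0 h1
  rw [vonNeumannEntropy, extTrace, (CFC.posPart_eq_self _).2 h, (CFC.negPart_eq_zero_iff _).2 h]
  simp [posTrace]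

lemma re_inner_cfc_negMulLog_le {T : H →L[ℂ] H} (h0 : 0 ≤ T) (h1 : T ≤ 1) {a : ℝ} (ha : 0 < a)
    (u : H) :
    (⟪u, cfc Real.negMulLog T u⟫_ℂ).re ≤
      a * ‖u‖ ^ 2 - (Real.log a + 1) * (⟪u, T u⟫_ℂ).re := by
  have hsa : IsSelfAdjoint T := IsSelfAdjoint.of_nonneg h0
  have h : cfc Real.negMulLog T ≤ cfc (fun x : ℝ => a - (Real.log a + 1) * x) T :=
    cfc_mono (fun x hx => negMulLog_le_tangent ha (spectrum_mem_unitInterval h0 h1 x hx).1)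
      Real.continuous_negMulLog.continuousOn
  rw [cfc_sub (fun _ => a) (fun x => (Real.log a + 1) * x) T, cfc_const a T,
    cfc_const_mul_id (Real.log a + 1) T, Algebra.algebraMap_eq_smul_one] at h
  refine (re_inner_mono h u).trans (le_of_eq ?_)
  have hu : (⟪u, u⟫_ℂ).re = ‖u‖ ^ 2 := inner_self_eq_norm_sq (𝕜 := ℂ) u
  simp only [sub_apply, smul_apply, one_apply_eq_self, inner_sub_right, Complex.sub_re,
    inner_smul_right_eq_smul, Complex.smul_re, smul_eq_mul, hu]

lemma le_re_inner_cfc_negMulLog {T : H →L[ℂ] H} (h0 : 0 ≤ T) (h1 : T ≤ 1) {c : ℝ} (hc : 0 < c)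
    (u : H) :
    (Real.log c + 1) * (⟪u, T u⟫_ℂ).re - c * ‖T u‖ ^ 2 ≤
      (⟪u, cfc Real.negMulLog T u⟫_ℂ).re := by
  have hsa : IsSelfAdjoint T := IsSelfAdjoint.of_nonneg h0
  have h : cfc (fun x : ℝ => (Real.log c + 1) * x - c * x ^ 2) T ≤ cfc Real.negMulLog T :=
    cfc_mono (fun x hx => le_negMulLog hc (spectrum_mem_unitInterval h0 h1 x hx).1) (by fun_prop)
      Real.continuous_negMulLog.continuousOn
  rw [cfc_sub (fun x => (Real.log c + 1) * x) (fun x => c * x ^ 2) T,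
    cfc_const_mul_id (Real.log c + 1) T, cfc_const_mul c (fun x => x ^ 2) T, cfc_pow_id T 2] at h
  refine le_trans (le_of_eq ?_) (re_inner_mono h u)
  have hu : (⟪u, (T ^ 2) u⟫_ℂ).re = ‖T u‖ ^ 2 := by
    rw [sq T, mul_apply_eq_comp,
      ← ((ContinuousLinearMap.nonneg_iff_isPositive T).1 h0).inner_left_eq_inner_right]
    exact inner_self_eq_norm_sq (𝕜 := ℂ) (T u)
  simp only [sub_apply, smul_apply, inner_sub_right, Complex.sub_re,
    inner_smul_right_eq_smul, Complex.smul_re, smul_eq_mul, hu]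

lemma tsum_quadForm_le_of_le_one {T : H →L[ℂ] H} (h1 : T ≤ 1) {ι : Type*} (u : ι → H) :
    ∑' i, quadForm T (u i) ≤ ∑' i, ‖u i‖ₑ ^ 2 := by
  refine ENNReal.tsum_le_tsum fun i => ?_
  rw [quadForm, ← ofReal_norm, ← ENNReal.ofReal_pow (norm_nonneg _)]
  refine ENNReal.ofReal_le_ofReal ((re_inner_mono h1 (u i)).trans (le_of_eq ?_))
  exact inner_self_eq_norm_sq (𝕜 := ℂ) (u i)

/-- Jensen's inequality for the concave function `-x log x` and the state `∑ᵢ uᵢ ⊗ uᵢ`. It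
follows from the operator inequality `Φ(T) ≤ a - (log a + 1) T` given by the tangent line of `Φ` at
`a`, taken at the expectation of `T` in that state. -/
lemma tsum_quadForm_cfc_negMulLog_le {T : H →L[ℂ] H} (h0 : 0 ≤ T) (h1 : T ≤ 1) {ι : Type*}
    {u : ι → H} (hu : ∑' i, ‖u i‖ₑ ^ 2 = 1) :
    ∑' i, quadForm (cfc Real.negMulLog T) (u i) ≤
      ENNReal.ofReal (Real.negMulLog (∑' i, quadForm T (u i)).toReal) := by
  set p : ℝ := (∑' i, quadForm T (u i)).toReal with hp
  have hfin : ∑' i, quadForm T (u i) ≠ ∞ :=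
    ne_top_of_le_ne_top (by rw [hu]; simp) (tsum_quadForm_le_of_le_one h1 u)
  have hsT : HasSum (fun i => (⟪u i, T (u i)⟫_ℂ).re) p := by
    have := (ENNReal.hasSum_toReal hfin)
    rw [← ENNReal.tsum_toReal_eq (fun i => quadForm_ne_top _ _)] at this
    simpa only [toReal_quadForm h0] using this
  have hsu : HasSum (fun i => ‖u i‖ ^ 2) 1 := by
    have := ENNReal.hasSum_toReal (f := fun i => ‖u i‖ₑ ^ 2) (by rw [hu]; simp)
    rw [← ENNReal.tsum_toReal_eq (fun i => by simp), hu] at this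
    simpa using this
  have key : ∀ a : ℝ, 0 < a → ∑' i, quadForm (cfc Real.negMulLog T) (u i) ≤
      ENNReal.ofReal (a - (Real.log a + 1) * p) := by
    intro a ha
    have hs := (hsu.mul_left a).sub (hsT.mul_left (Real.log a + 1))
    rw [mul_one] at hs
    have hle := fun i => re_inner_cfc_negMulLog_le h0 h1 ha (u i)
    have hnn := fun i => re_inner_nonneg (cfc_negMulLog_nonneg h0 h1) (u i)
    rw [← hs.tsum_eq, ENNReal.ofReal_tsum_of_nonneg (fun i => (hnn i).trans (hle i)) hs.summable]
    exact ENNReal.tsum_le_tsum fun i => ENNReal.ofReal_le_ofReal (hle i)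
  rcases (show 0 ≤ p from ENNReal.toReal_nonneg).eq_or_lt with h | h
  · -- If the expectation vanishes there is no tangent line at it; let `a` tend to `0` instead.
    rw [← h, Real.negMulLog_zero, ENNReal.ofReal_zero]
    refine ENNReal.le_of_forall_pos_le_add fun ε hε _ => ?_
    have := key ε (by exact_mod_cast hε)
    rw [← h] at this
    simpa using this
  · -- At `a = p` the tangent line takes the value `Φ(p)`.
    refine (key p h).trans (le_of_eq ?_)
    rw [Real.negMulLog]
    ring_nf

/-- A lower bound for the von Neumann entropy in terms of the purity `tr T²`. -/
lemma le_vonNeumannEntropy {T : H →L[ℂ] H} (h0 : 0 ≤ T) (h1 : T ≤ 1) (htr : posTrace T = 1)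
    {c : ℝ} (hc : 0 < c) :
    ((Real.log c + 1 - c * (∑' i, ‖T (onb H i)‖ₑ ^ 2).toReal : ℝ) : EReal) ≤
      vonNeumannEntropy T := by
  rw [vonNeumannEntropy_eq_posTrace h0 h1]
  by_cases hΦ : posTrace (cfc Real.negMulLog T) = ∞
  · rw [hΦ]
    simp
  have hsT : HasSum (fun i => (⟪onb H i, T (onb H i)⟫_ℂ).re) 1 := by
    rw [posTrace_eq_tsum_quadForm] at htr
    have := ENNReal.hasSum_toReal (f := fun i => quadForm T (onb H i)) (by rw [htr]; simp)
    rw [← ENNReal.tsum_toReal_eq (fun i => quadForm_ne_top _ _), htr] at this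
    simpa only [toReal_quadForm h0, ENNReal.toReal_one] using this
  have hsq : Summable fun i => ‖T (onb H i)‖ ^ 2 := by
    refine Summable.of_nonneg_of_le (fun i => by positivity) (fun i => ?_)
      ((hsT.summable.mul_left (‖CFC.sqrt T‖ ^ 2)))
    have h := quadForm_eq_enorm_sqrt h0 (onb H i)
    have h' : (⟪onb H i, T (onb H i)⟫_ℂ).re = ‖CFC.sqrt T (onb H i)‖ ^ 2 := by
      rw [← toReal_quadForm h0, h]
      simp
    rw [h', ← mul_pow, ← sqrt_sqrt_apply h0]
    gcongr
    exact ContinuousLinearMap.le_opNorm _ _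
  have hT2 : (∑' i, ‖T (onb H i)‖ₑ ^ 2).toReal = ∑' i, ‖T (onb H i)‖ ^ 2 := by
    rw [ENNReal.tsum_toReal_eq (fun i => by simp)]
    simp
  have hsΦ : HasSum (fun i => (⟪onb H i, cfc Real.negMulLog T (onb H i)⟫_ℂ).re)
      (posTrace (cfc Real.negMulLog T)).toReal := by
    rw [posTrace_eq_tsum_quadForm] at hΦ ⊢
    have := ENNReal.hasSum_toReal hΦ
    rw [← ENNReal.tsum_toReal_eq (fun i => quadForm_ne_top _ _)] at this
    simpa only [toReal_quadForm (cfc_negMulLog_nonneg h0 h1)] using this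
  have hle := hasSum_le (fun i => le_re_inner_cfc_negMulLog h0 h1 hc (onb H i))
    ((hsT.mul_left (Real.log c + 1)).sub (hsq.hasSum.mul_left c)) hsΦ
  rw [mul_one] at hle
  rw [hT2, ← EReal.coe_ennreal_toReal hΦ]
  exact_mod_cast hle

end Entropy

/-! ### Traces against shifted operators -/

variable {d : ℕ}

lemma opCheck_opCheck (S : L2 d →L[ℂ] L2 d) : opCheck (opCheck S) = S := by
  have h : ∀ f : L2 d, parity (parity f) = f := by
    intro f
    refine Lp.ext ?_
    have hm := Measure.measurePreserving_neg (volume : Measure (EuclideanSpace ℝ (Fin d)))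
    have h1 : ∀ g : L2 d, parity g =ᵐ[volume] fun t => g (-t) := fun g =>
      Lp.coeFn_compMeasurePreserving g hm
    filter_upwards [h1 (parity f), hm.quasiMeasurePreserving.ae (h1 f)] with t h2 h3
    rw [h2, h3, neg_neg]
  ext1 f
  simp only [opCheck, ContinuousLinearMap.comp_apply, LinearIsometry.coe_toContinuousLinearMap, h]

section OperatorShift

variable {S : L2 d →L[ℂ] L2 d}

lemma inner_opShift (z : Phase d) (S : L2 d →L[ℂ] L2 d) (u : L2 d) :
    ⟪u, opShift z S u⟫_ℂ =
      ⟪ContinuousLinearMap.adjoint (tfShift z).toContinuousLinearMap u,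
        S (ContinuousLinearMap.adjoint (tfShift z).toContinuousLinearMap u)⟫_ℂ := by
  rw [ContinuousLinearMap.adjoint_inner_left]
  rfl

lemma opShift_nonneg (hS : 0 ≤ S) (z : Phase d) : 0 ≤ opShift z S := by
  rw [ContinuousLinearMap.nonneg_iff_isPositive] at hS ⊢
  exact hS.conj_adjoint _

lemma quadForm_opShift (hS : 0 ≤ S) (z : Phase d) (u : L2 d) :
    quadForm (opShift z S) u = ∑' k, ‖⟪tfShift z (sqrtVec S k), u⟫_ℂ‖ₑ ^ 2 := by
  rw [quadForm, inner_opShift, ← quadForm, quadForm_eq_tsum hS]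
  refine tsum_congr fun k => ?_
  rw [ContinuousLinearMap.adjoint_inner_right]
  rfl

/-- The translates of a trace class operator depend continuously on `z` in operator norm, so that
`χ_Ω / |Ω| ⋆ S` is a genuine Bochner integral. -/
lemma continuous_opShift (hS : 0 ≤ S) (hfin : posTrace S ≠ ∞) :
    Continuous fun z : Phase d => opShift z S := by
  have hsum : Summable fun i => ‖sqrtVec S i‖ ^ 2 :=
    summable_norm_sq_of_tsum_ne_top (by rwa [tsum_enorm_sq_sqrtVec hS])
  have h : ∀ z : Phase d, opShift z S = ∑' i, InnerProductSpace.rankOne ℂ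
      (tfShift z (sqrtVec S i)) (tfShift z (sqrtVec S i)) := by
    intro z
    have h1 := ((hasSum_rankOne_sqrtVec hS hfin).mapL
      ((ContinuousLinearMap.compL ℂ (L2 d) (L2 d) (L2 d)).flip
        (ContinuousLinearMap.adjoint (tfShift z).toContinuousLinearMap))).mapL
      (ContinuousLinearMap.compL ℂ (L2 d) (L2 d) (L2 d) (tfShift z).toContinuousLinearMap)
    refine (h1.tsum_eq.symm.trans (tsum_congr fun i => ?_))
    ext1 u
    simp [InnerProductSpace.rankOne_apply, ContinuousLinearMap.adjoint_inner_right]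
  simp only [h]
  refine continuous_tsum (fun i => ?_) hsum fun i z => ?_
  · exact continuous_rankOne_self.comp (continuous_tfShift (sqrtVec S i))
  · rw [InnerProductSpace.norm_rankOne, (tfShift z).norm_map, sq]

/-- The trace `tr (B α_z(S)) ∈ [0, ∞]` for positive `B` and `S`, expressed through the decomposition
`α_z(S) = ∑ᵢ π(z) vᵢ ⊗ π(z) vᵢ` with `vᵢ = S ^ (1/2) eᵢ`. -/
def shiftTrace (S B : L2 d →L[ℂ] L2 d) (z : Phase d) : ℝ≥0∞ :=
  ∑' i, quadForm B (tfShift z (sqrtVec S i))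

lemma measurable_quadForm_tfShift (B : L2 d →L[ℂ] L2 d) (u : L2 d) :
    Measurable fun z : Phase d => quadForm B (tfShift z u) := by
  refine ENNReal.measurable_ofReal.comp (Continuous.measurable ?_)
  exact Complex.continuous_re.comp
    ((continuous_tfShift u).inner (B.continuous.comp (continuous_tfShift u)))

lemma measurable_shiftTrace (S B : L2 d →L[ℂ] L2 d) : Measurable (shiftTrace S B) :=
  Measurable.tsum fun i => measurable_quadForm_tfShift B (sqrtVec S i)

lemma shiftTrace_opShift (hS : 0 ≤ S) (t z : Phase d) :
    shiftTrace S (opShift t S) z = shiftTrace S S (z - t) := by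
  unfold shiftTrace
  refine tsum_congr fun i => ?_
  rw [quadForm_opShift hS, quadForm_eq_tsum hS]
  refine tsum_congr fun k => ?_
  rw [← ofReal_norm, ← norm_inner_tfShift_sub, ofReal_norm]

lemma shiftTrace_opShift_comm (hS : 0 ≤ S) (t z : Phase d) :
    shiftTrace S (opShift t S) z = shiftTrace S (opShift z S) t := by
  unfold shiftTrace
  simp only [quadForm_opShift hS]
  rw [ENNReal.tsum_comm]
  simp only [enorm_inner_comm]

lemma tsum_enorm_sq_tfShift_sqrtVec (hS : 0 ≤ S) (htr : posTrace S = 1) (z : Phase d) :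
    ∑' i, ‖tfShift z (sqrtVec S i)‖ₑ ^ 2 = 1 := by
  simp only [LinearIsometry.enorm_map]
  rw [tsum_enorm_sq_sqrtVec hS, htr]

lemma quadForm_opShift_le (hS : 0 ≤ S) (htr : posTrace S = 1) (z : Phase d) (u : L2 d) :
    quadForm (opShift z S) u ≤ ‖u‖ₑ ^ 2 := by
  rw [quadForm_opShift hS]
  calc ∑' k, ‖⟪tfShift z (sqrtVec S k), u⟫_ℂ‖ₑ ^ 2
      ≤ ∑' k, ‖tfShift z (sqrtVec S k)‖ₑ ^ 2 * ‖u‖ₑ ^ 2 := by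
        refine ENNReal.tsum_le_tsum fun k => ?_
        rw [← mul_pow]
        gcongr
        simp only [← ofReal_norm]
        rw [← ENNReal.ofReal_mul (norm_nonneg _)]
        exact ENNReal.ofReal_le_ofReal (norm_inner_le_norm _ _)
    _ = ‖u‖ₑ ^ 2 := by
        rw [ENNReal.tsum_mul_right, tsum_enorm_sq_tfShift_sqrtVec hS htr, one_mul]

lemma shiftTrace_self_le_one (hS : 0 ≤ S) (htr : posTrace S = 1) (z : Phase d) :
    shiftTrace S S z ≤ 1 := by
  rw [← sub_zero z, ← shiftTrace_opShift hS, ← tsum_enorm_sq_tfShift_sqrtVec hS htr z]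
  exact ENNReal.tsum_le_tsum fun i => quadForm_opShift_le hS htr _ _

lemma totalCorrelation_eq (hS : 0 ≤ S) (htr : posTrace S = 1) (z : Phase d) :
    totalCorrelation S z = (shiftTrace S S z).toReal := by
  rw [totalCorrelation, opConv, opCheck_opCheck,
    opTrace_comp hS (by rw [htr]; simp) (opShift_nonneg hS z), Complex.ofReal_re]
  congr 1
  unfold shiftTrace
  simp only [quadForm_opShift hS, quadForm_eq_tsum hS]
  rw [ENNReal.tsum_comm]
  simp only [enorm_inner_comm]

lemma totalCorrelation_sub_comm (hS : 0 ≤ S) (htr : posTrace S = 1) (z w : Phase d) :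
    totalCorrelation S (w - z) = totalCorrelation S (z - w) := by
  rw [totalCorrelation_eq hS htr, totalCorrelation_eq hS htr, ← shiftTrace_opShift hS,
    shiftTrace_opShift_comm hS, shiftTrace_opShift hS]

/-- The trace formula `∫ tr (B α_z(S)) dz = tr B · tr S`, a consequence of Moyal's identity. -/
lemma lintegral_shiftTrace (hS : 0 ≤ S) (htr : posTrace S = 1) {B : L2 d →L[ℂ] L2 d} (hB : 0 ≤ B) :
    ∫⁻ z, shiftTrace S B z = posTrace B := by
  unfold shiftTrace
  rw [lintegral_tsum fun i => (measurable_quadForm_tfShift B (sqrtVec S i)).aemeasurable]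
  have h : ∀ i, ∫⁻ z, quadForm B (tfShift z (sqrtVec S i)) =
      ‖sqrtVec S i‖ₑ ^ 2 * posTrace B := by
    intro i
    simp only [quadForm_eq_tsum hB]
    rw [lintegral_tsum fun j => ?_]
    · rw [← tsum_enorm_sq_sqrtVec hB, ← ENNReal.tsum_mul_left]
      refine tsum_congr fun j => ?_
      simp only [enorm_inner_comm (sqrtVec B j)]
      exact lintegral_enorm_sq_inner_tfShift _ _
    · exact ((continuous_const.inner
        (continuous_tfShift (sqrtVec S i))).enorm.measurable.pow_const 2).aemeasurable
  simp only [h]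
  rw [ENNReal.tsum_mul_right, tsum_enorm_sq_sqrtVec hS, htr, one_mul]

end OperatorShift

/-! ### The mixed state of a compact set -/

section Localization

variable {S : L2 d →L[ℂ] L2 d} {Ω : Set (Phase d)}

/-- The operator `χ_Ω / |Ω| ⋆ S`, a mixture of the translates `α_z(S)`, `z ∈ Ω`. -/
def mixedState (Ω : Set (Phase d)) (S : L2 d →L[ℂ] L2 d) : L2 d →L[ℂ] L2 d :=
  funOpConv (fun z => (normIndicator Ω z : ℂ)) S

lemma volume_real_pos (hΩ : IsCompact Ω) (hpos : 0 < volume Ω) : 0 < volume.real Ω :=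
  ENNReal.toReal_pos hpos.ne' hΩ.measure_lt_top.ne

lemma mixedState_eq (hΩ : IsCompact Ω) :
    mixedState Ω S = ((volume.real Ω)⁻¹ : ℂ) • ∫ z in Ω, opShift z S := by
  rw [mixedState, funOpConv, ← integral_smul, ← integral_indicator hΩ.measurableSet]
  congr 1
  ext1 z
  by_cases hz : z ∈ Ω <;> simp [normIndicator, hz]

lemma inner_mixedState (hS : 0 ≤ S) (htr : posTrace S = 1) (hΩ : IsCompact Ω) (u : L2 d) :
    ⟪u, mixedState Ω S u⟫_ℂ =
      (((volume.real Ω)⁻¹ * ∫ z in Ω, (quadForm (opShift z S) u).toReal : ℝ) : ℂ) := by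
  have hint : IntegrableOn (fun z => opShift z S) Ω :=
    (continuous_opShift hS (by rw [htr]; simp)).continuousOn.integrableOn_compact hΩ
  have h1 : (∫ z in Ω, opShift z S) u = ∫ z in Ω, opShift z S u :=
    (ContinuousLinearMap.integral_apply hint u)
  have hint2 : IntegrableOn (fun z => opShift z S u) Ω :=
    (ContinuousLinearMap.apply ℂ (L2 d) u).integrable_comp hint
  rw [mixedState_eq hΩ, smul_apply, inner_smul_right, h1, ← integral_inner hint2]
  push_cast
  rw [← integral_complex_ofReal]
  congr 1
  refine integral_congr_ae (Filter.Eventually.of_forall fun z => ?_)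
  simp only
  rw [toReal_quadForm (opShift_nonneg hS z), ← ofReal_re_inner (opShift_nonneg hS z)]
  rfl

lemma mixedState_nonneg (hS : 0 ≤ S) (htr : posTrace S = 1) (hΩ : IsCompact Ω) :
    0 ≤ mixedState Ω S := by
  rw [ContinuousLinearMap.nonneg_iff_isPositive, ContinuousLinearMap.isPositive_iff_complex]
  intro u
  have h : ⟪mixedState Ω S u, u⟫_ℂ =
      (((volume.real Ω)⁻¹ * ∫ z in Ω, (quadForm (opShift z S) u).toReal : ℝ) : ℂ) := by
    rw [← inner_conj_symm, inner_mixedState hS htr hΩ, Complex.conj_ofReal]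
  rw [h]
  refine ⟨by simp, ?_⟩
  have : 0 ≤ (volume.real Ω)⁻¹ * ∫ z in Ω, (quadForm (opShift z S) u).toReal := by positivity
  simpa using this

lemma measurable_quadForm_opShift (hS : 0 ≤ S) (htr : posTrace S = 1) (u : L2 d) :
    Measurable fun z : Phase d => quadForm (opShift z S) u := by
  refine ENNReal.measurable_ofReal.comp (Continuous.measurable ?_)
  exact Complex.continuous_re.comp (continuous_const.inner
    ((continuous_opShift hS (by rw [htr]; simp)).clm_apply continuous_const))

lemma quadForm_mixedState (hS : 0 ≤ S) (htr : posTrace S = 1) (hΩ : IsCompact Ω)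
    (hpos : 0 < volume Ω) (u : L2 d) :
    quadForm (mixedState Ω S) u = (volume Ω)⁻¹ * ∫⁻ z in Ω, quadForm (opShift z S) u := by
  have hfin : ∫⁻ z in Ω, quadForm (opShift z S) u ≠ ∞ := by
    refine ne_top_of_le_ne_top ?_ (lintegral_mono fun z => quadForm_opShift_le hS htr z u)
    rw [setLIntegral_const]
    exact ENNReal.mul_ne_top (by simp) hΩ.measure_lt_top.ne
  rw [quadForm, inner_mixedState hS htr hΩ, Complex.ofReal_re,
    integral_toReal (measurable_quadForm_opShift hS htr u).aemeasurable
      (Filter.Eventually.of_forall fun z => (quadForm_ne_top _ _).lt_top),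
    ENNReal.ofReal_mul (by positivity), ENNReal.ofReal_toReal hfin,
    ENNReal.ofReal_inv_of_pos (volume_real_pos hΩ hpos), Measure.real,
    ENNReal.ofReal_toReal hΩ.measure_lt_top.ne]

lemma mixedState_le_one (hS : 0 ≤ S) (htr : posTrace S = 1) (hΩ : IsCompact Ω)
    (hpos : 0 < volume Ω) : mixedState Ω S ≤ 1 := by
  have h0 := mixedState_nonneg hS htr hΩ
  rw [ContinuousLinearMap.le_def, ContinuousLinearMap.isPositive_def']
  refine ⟨(IsSelfAdjoint.one _).sub (IsSelfAdjoint.of_nonneg h0), fun u => ?_⟩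
  have hq : quadForm (mixedState Ω S) u ≤ ‖u‖ₑ ^ 2 := by
    rw [quadForm_mixedState hS htr hΩ hpos]
    calc (volume Ω)⁻¹ * ∫⁻ z in Ω, quadForm (opShift z S) u
        ≤ (volume Ω)⁻¹ * ∫⁻ _ in Ω, ‖u‖ₑ ^ 2 := by
          gcongr with z
          exact quadForm_opShift_le hS htr z u
      _ = ‖u‖ₑ ^ 2 := by
          rw [setLIntegral_const, mul_comm (‖u‖ₑ ^ 2), ← mul_assoc,
            ENNReal.inv_mul_cancel hpos.ne' hΩ.measure_lt_top.ne, one_mul]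
  have hq' : (⟪u, mixedState Ω S u⟫_ℂ).re ≤ ‖u‖ ^ 2 := by
    rw [← toReal_quadForm h0]
    have := ENNReal.toReal_mono (by simp) hq
    simpa using this
  have hu : (⟪u, u⟫_ℂ).re = ‖u‖ ^ 2 := inner_self_eq_norm_sq (𝕜 := ℂ) u
  rw [ContinuousLinearMap.reApplyInnerSelf_apply, ← inner_conj_symm, RCLike.conj_re, sub_apply,
    one_apply_eq_self, inner_sub_right, map_sub]
  change 0 ≤ (⟪u, u⟫_ℂ).re - (⟪u, mixedState Ω S u⟫_ℂ).re
  linarith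

lemma tsum_quadForm_mixedState (hS : 0 ≤ S) (htr : posTrace S = 1) (hΩ : IsCompact Ω)
    (hpos : 0 < volume Ω) {ι : Type*} [Countable ι] (u : ι → L2 d) :
    ∑' i, quadForm (mixedState Ω S) (u i) =
      (volume Ω)⁻¹ * ∫⁻ t in Ω, ∑' i, quadForm (opShift t S) (u i) := by
  rw [lintegral_tsum fun i => (measurable_quadForm_opShift hS htr (u i)).aemeasurable,
    ← ENNReal.tsum_mul_left]
  exact tsum_congr fun i => quadForm_mixedState hS htr hΩ hpos (u i)

lemma shiftTrace_mixedState (hS : 0 ≤ S) (htr : posTrace S = 1) (hΩ : IsCompact Ω)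
    (hpos : 0 < volume Ω) (z : Phase d) :
    shiftTrace S (mixedState Ω S) z = (volume Ω)⁻¹ * ∫⁻ t in Ω, shiftTrace S S (z - t) := by
  rw [shiftTrace, tsum_quadForm_mixedState hS htr hΩ hpos]
  congr 1
  exact lintegral_congr fun t => shiftTrace_opShift hS t z

lemma shiftTrace_mixedState_le_one (hS : 0 ≤ S) (htr : posTrace S = 1) (hΩ : IsCompact Ω)
    (hpos : 0 < volume Ω) (z : Phase d) : shiftTrace S (mixedState Ω S) z ≤ 1 := by
  rw [← tsum_enorm_sq_tfShift_sqrtVec hS htr z]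
  exact tsum_quadForm_le_of_le_one (mixedState_le_one hS htr hΩ hpos) _

lemma posTrace_mixedState (hS : 0 ≤ S) (htr : posTrace S = 1) (hΩ : IsCompact Ω)
    (hpos : 0 < volume Ω) : posTrace (mixedState Ω S) = 1 := by
  rw [posTrace_eq_tsum_quadForm, tsum_quadForm_mixedState hS htr hΩ hpos]
  have h : ∀ t : Phase d, ∑' i, quadForm (opShift t S) (onb (L2 d) i) = 1 := by
    intro t
    simp only [quadForm_opShift hS]
    rw [ENNReal.tsum_comm]
    simp only [enorm_inner_comm _ (onb (L2 d) _), tsum_enorm_sq_inner_onb]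
    exact tsum_enorm_sq_tfShift_sqrtVec hS htr t
  simp only [h]
  rw [setLIntegral_const, one_mul, ENNReal.inv_mul_cancel hpos.ne' hΩ.measure_lt_top.ne]

/-- The purity `tr T²` of `T = χ_Ω / |Ω| ⋆ S` is the average over `Ω` of `tr (T α_t(S))`. -/
lemma tsum_enorm_sq_mixedState (hS : 0 ≤ S) (htr : posTrace S = 1) (hΩ : IsCompact Ω)
    (hpos : 0 < volume Ω) :
    ∑' i, ‖mixedState Ω S (onb (L2 d) i)‖ₑ ^ 2 =
      (volume Ω)⁻¹ * ∫⁻ t in Ω, shiftTrace S (mixedState Ω S) t := by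
  set T := mixedState Ω S with hT
  have h0 : 0 ≤ T := mixedState_nonneg hS htr hΩ
  -- `tr T² = ∑ᵢ ⟨T ^ (1/2) eᵢ, T T ^ (1/2) eᵢ⟩`, where only the middle factor `T` is expanded.
  have h1 : ∀ i, ‖T (onb (L2 d) i)‖ₑ ^ 2 = quadForm T (sqrtVec T i) := by
    intro i
    rw [quadForm_eq_enorm_sqrt h0, sqrtVec, sqrt_sqrt_apply h0]
  simp only [h1]
  rw [hT, tsum_quadForm_mixedState hS htr hΩ hpos, ← hT]
  congr 1
  refine lintegral_congr fun t => ?_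
  simp only [shiftTrace, quadForm_opShift hS, quadForm_eq_tsum h0]
  rw [ENNReal.tsum_comm]
  simp only [enorm_inner_comm]

lemma setIntegral_totalCorrelation_sub (hS : 0 ≤ S) (htr : posTrace S = 1) (hΩ : IsCompact Ω)
    (hpos : 0 < volume Ω) (z : Phase d) :
    ∫ t in Ω, totalCorrelation S (z - t) =
      volume.real Ω * (shiftTrace S (mixedState Ω S) z).toReal := by
  have hm : Measurable fun t => shiftTrace S S (z - t) :=
    (measurable_shiftTrace S S).comp (measurable_const.sub measurable_id)
  simp only [totalCorrelation_eq hS htr]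
  rw [integral_toReal hm.aemeasurable (Filter.Eventually.of_forall fun t =>
      (shiftTrace_self_le_one hS htr _).trans_lt ENNReal.one_lt_top),
    shiftTrace_mixedState hS htr hΩ hpos, ENNReal.toReal_mul, ENNReal.toReal_inv, ← mul_assoc,
    ← Measure.real, mul_inv_cancel₀ (volume_real_pos hΩ hpos).ne', one_mul]

/-- The convolution `χ_Ω / |Ω| ∗ S̃` is the function `z ↦ tr (T α_z(S))`, `T = χ_Ω / |Ω| ⋆ S`. -/
lemma funConv_normIndicator_totalCorrelation (hS : 0 ≤ S) (htr : posTrace S = 1)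
    (hΩ : IsCompact Ω) (hpos : 0 < volume Ω) (z : Phase d) :
    funConv (normIndicator Ω) (totalCorrelation S) z =
      (shiftTrace S (mixedState Ω S) z).toReal := by
  have h : ∀ t, (ContinuousLinearMap.mul ℝ ℝ (normIndicator Ω t)) (totalCorrelation S (z - t)) =
      Ω.indicator (fun t => (volume.real Ω)⁻¹ * totalCorrelation S (z - t)) t := by
    intro t
    by_cases ht : t ∈ Ω <;> simp [normIndicator, ht]
  rw [funConv, convolution_def]
  simp only [h]
  rw [integral_indicator hΩ.measurableSet, integral_const_mul,
    setIntegral_totalCorrelation_sub hS htr hΩ hpos, ← mul_assoc,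
    inv_mul_cancel₀ (volume_real_pos hΩ hpos).ne', one_mul]

/-- The average lack of concentration is `1 - |Ω| tr T²` for `T = χ_Ω / |Ω| ⋆ S`. -/
lemma ALC_totalCorrelation (hS : 0 ≤ S) (htr : posTrace S = 1) (hΩ : IsCompact Ω)
    (hpos : 0 < volume Ω) :
    ALC (totalCorrelation S) Ω =
      1 - volume.real Ω * (∑' i, ‖mixedState Ω S (onb (L2 d) i)‖ₑ ^ 2).toReal := by
  have hvol := (volume_real_pos hΩ hpos).ne'
  have hinner : ∀ z : Phase d, ∫ z' in (fun w => w - z) '' Ω, totalCorrelation S z' =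
      volume.real Ω * (shiftTrace S (mixedState Ω S) z).toReal := by
    intro z
    rw [(measurePreserving_sub_right volume z).setIntegral_image_emb
      (MeasurableEquiv.subRight z).measurableEmbedding]
    simp only [totalCorrelation_sub_comm hS htr]
    exact setIntegral_totalCorrelation_sub hS htr hΩ hpos z
  have hlt : ∀ z : Phase d, shiftTrace S (mixedState Ω S) z < ∞ := fun z =>
    (shiftTrace_mixedState_le_one hS htr hΩ hpos z).trans_lt ENNReal.one_lt_top
  have hfin : ∫⁻ z in Ω, shiftTrace S (mixedState Ω S) z ≠ ∞ := by
    refine ne_top_of_le_ne_top ?_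
      (lintegral_mono fun z => shiftTrace_mixedState_le_one hS htr hΩ hpos z)
    rw [setLIntegral_const, one_mul]
    exact hΩ.measure_lt_top.ne
  have hint : IntegrableOn (fun z => (shiftTrace S (mixedState Ω S) z).toReal) Ω :=
    integrable_toReal_of_lintegral_ne_top (measurable_shiftTrace _ _).aemeasurable hfin
  have hone : IntegrableOn (fun _ : Phase d => (1 : ℝ)) Ω :=
    integrableOn_const hΩ.measure_lt_top.ne
  rw [ALC]
  simp only [hinner]
  rw [integral_sub hone (hint.const_mul _), integral_const_mul, setIntegral_const,
    integral_toReal (measurable_shiftTrace _ _).aemeasurable (Filter.Eventually.of_forall hlt),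
    tsum_enorm_sq_mixedState hS htr hΩ hpos, ENNReal.toReal_mul, ENNReal.toReal_inv,
    ← Measure.real, smul_eq_mul]
  field_simp

theorem vonNeumannEntropy_mixedState_le (hS : 0 ≤ S) (htr : posTrace S = 1) (hΩ : IsCompact Ω)
    (hpos : 0 < volume Ω) :
    vonNeumannEntropy (mixedState Ω S) ≤
      diffEntropy (funConv (normIndicator Ω) (totalCorrelation S)) := by
  have h0 := mixedState_nonneg hS htr hΩ
  have h1 := mixedState_le_one hS htr hΩ hpos
  have hp : ∀ z, 0 ≤ Real.negMulLog (shiftTrace S (mixedState Ω S) z).toReal := fun z =>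
    Real.negMulLog_nonneg ENNReal.toReal_nonneg (ENNReal.toReal_le_of_le_ofReal zero_le_one
      (by simpa using shiftTrace_mixedState_le_one hS htr hΩ hpos z))
  rw [vonNeumannEntropy_eq_posTrace h0 h1,
    ← lintegral_shiftTrace hS htr (cfc_negMulLog_nonneg h0 h1), diffEntropy]
  simp only [funConv_normIndicator_totalCorrelation hS htr hΩ hpos]
  have hneg : ∀ z, ENNReal.ofReal (-Real.negMulLog (shiftTrace S (mixedState Ω S) z).toReal) = 0 :=
    fun z => ENNReal.ofReal_of_nonpos (neg_nonpos.2 (hp z))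
  simp only [hneg, lintegral_zero, EReal.coe_ennreal_zero, sub_zero]
  rw [EReal.coe_ennreal_le_coe_ennreal_iff]
  exact lintegral_mono fun z =>
    tsum_quadForm_cfc_negMulLog_le h0 h1 (tsum_enorm_sq_tfShift_sqrtVec hS htr z)

theorem le_vonNeumannEntropy_mixedState (hS : 0 ≤ S) (htr : posTrace S = 1) (hΩ : IsCompact Ω)
    (hpos : 0 < volume Ω) :
    ((Real.log (volume.real Ω) + ALC (totalCorrelation S) Ω : ℝ) : EReal) ≤
      vonNeumannEntropy (mixedState Ω S) := by
  have h := le_vonNeumannEntropy (mixedState_nonneg hS htr hΩ) (mixedState_le_one hS htr hΩ hpos)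
    (posTrace_mixedState hS htr hΩ hpos) (volume_real_pos hΩ hpos)
  rwa [ALC_totalCorrelation hS htr hΩ hpos, ← add_sub_assoc]

end Localization

end QHA

end

theorem mainTheorem1 (d : ℕ) (Ω : Set (QHA.Phase d)) (hΩ : IsCompact Ω)
    (hΩpos : 0 < volume Ω)
    (S : QHA.L2 d →L[ℂ] QHA.L2 d) (hSpos : S.IsPositive) (hStc : QHA.IsTraceClass S)
    (hStr : QHA.opTrace S = 1) :
    ((Real.log (volume.real Ω) + QHA.ALC (QHA.totalCorrelation S) Ω : ℝ) : EReal) ≤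
        QHA.vonNeumannEntropy
          (QHA.funOpConv (fun z => (QHA.normIndicator Ω z : ℂ)) S) ∧
      QHA.vonNeumannEntropy
          (QHA.funOpConv (fun z => (QHA.normIndicator Ω z : ℂ)) S) ≤
        QHA.diffEntropy (QHA.funConv (QHA.normIndicator Ω) (QHA.totalCorrelation S)) := by
  have hS : 0 ≤ S := (ContinuousLinearMap.nonneg_iff_isPositive S).2 hSpos
  have htr : QHA.posTrace S = 1 := QHA.posTrace_eq_one hS hStr
  exact ⟨QHA.le_vonNeumannEntropy_mixedState hS htr hΩ hΩpos,
    QHA.vonNeumannEntropy_mixedState_le hS htr hΩ hΩpos⟩
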